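/- Let $p$ be a prime, let $A$ be a commutative $\mathbb F_p$-algebra and let $n>1$ be an integer. Let $\Phi^n(A)$ be the $A$-$A$-bimodule which is $A$ as a left $A$-module and whose right action is $m\cdot a=a^{p^n}m$ for $a\in A$, $m\in\Phi^n(A)$. Let $\psi^n(A)=A/(a-a^{p^n} : a\in A)$ be the quotient of $A$ by the ideal generated by all the elements $a-a^{p^n}$. For an $\mathbb F_p$-algebra $R$ and an $R$-$R$-bimodule $B$ let $H_i(R,B)$ denote the Hochschild homology over $\mathbb F_p$, that is, the $i$-th homology of the Hochschild complex $C_m(R,B)=B\otimes R^{\otimes m}$ (tensor products over $\mathbb F_p$) with differential $\sum_{i=0}^{m}(-1)^i\partial_i$, where $$\partial_0(b\otimes r_1\otimes\cdots\otimes r_m)=br_1\otimes r_2\otimes\cdots\otimes r_m,$$ $$\partial_i(b\otimes r_1\otimes\cdots\otimes r_m)=b\otimes r_1\otimes\cdots\otimes r_ir_{i+1}\otimes\cdots\otimes r_m\quad(0<i<m),$$ $$\partial_m(b\otimes r_1\otimes\cdots\otimes r_m)=r_mb\otimes r_1\otimes\cdots\otimes r_{m-1}.$$ Then $$H_i(A,\Phi^n(A))=0\quad\text{for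 all } i>0,\qquad H_0(A,\Phi^n(A))\cong\psi^n(A),$$ where the isomorphism sends the homology class of $a\in A=C_0(A,\Phi^n(A))$ to the residue class of $a$ in $\psi^n(A)$. -/

import Mathlib

open CategoryTheory TensorProduct

universe u v w

namespace Hochschild

/-! ### The Hochschild complex of an associative algebra with coefficients in a bimodule

A bimodule `B` over a `k`-algebra `R` is a `k`-module with a left action of `R` and a
right action of `R` (encoded, as usual in Mathlib, as an action of `Rᵐᵒᵖ`: `b r` is
`MulOpposite.op r • b`); the two actions commute and are compatible with `k`. -/

section Complex

variable (k : Type u) [CommRing k] (R : Type v) [Ring R] [Algebra k R]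
variable (B : Type w) [AddCommGroup B] [Module k B] [Module R B] [Module Rᵐᵒᵖ B]
variable [IsScalarTower k R B] [IsScalarTower k Rᵐᵒᵖ B]

/-- The Hochschild `n`-chains `B ⊗ R^{⊗ n}`, tensor products over `k`. -/
abbrev Chains (n : ℕ) : Type _ := B ⊗[k] (⨂[k] _ : Fin n, R)

variable {R} in
/-- Multiplication of the adjacent entries at positions `i` and `i + 1` of a tuple. -/
def mulAdjacent {n : ℕ} (i : Fin n) (r : Fin (n + 1) → R) (l : Fin n) : R :=
  if l < i then r l.castSucc
  else if l = i then r l.castSucc * r l.succ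
  else r l.succ

variable {R} in
theorem mulAdjacent_update {n : ℕ} (i : Fin n) (r : Fin (n + 1) → R) (j : Fin (n + 1)) (x : R) :
    mulAdjacent i (Function.update r j x) =
      Function.update (mulAdjacent i r) (i.predAbove j)
        (if j = i.castSucc then x * r i.succ
          else if j = i.succ then r i.castSucc * x else x) := by
  ext l
  by_cases hj : i.castSucc < j
  · have hp : i.predAbove j = j.pred (Fin.ne_zero_of_lt hj) := Fin.predAbove_of_castSucc_lt _ _ hj
    rw [hp]
    simp only [mulAdjacent, Function.update_apply, Fin.ext_iff, Fin.lt_def, Fin.val_castSucc,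
      Fin.val_succ, Fin.val_pred] at hj ⊢
    split_ifs <;> first | rfl | omega | (congr 2; apply Fin.ext; simp; omega)
  · have hp : i.predAbove j = j.castPred (Fin.ne_last_of_lt (lt_of_le_of_lt (not_lt.mp hj)
        i.castSucc_lt_last)) := Fin.predAbove_of_le_castSucc _ _ (not_lt.mp hj)
    rw [hp]
    simp only [mulAdjacent, Function.update_apply, Fin.ext_iff, Fin.lt_def, Fin.val_castSucc,
      Fin.val_succ, Fin.coe_castPred] at hj ⊢
    split_ifs <;> first | rfl | omega | (congr 2; apply Fin.ext; simp; omega)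

/-- `r₁ ⊗ ⋯ ⊗ rₙ₊₁ ↦ r₁ ⊗ ⋯ ⊗ rᵢ rᵢ₊₁ ⊗ ⋯ ⊗ rₙ₊₁`. -/
noncomputable def mulAdjacentTensor {n : ℕ} (i : Fin n) :
    (⨂[k] _ : Fin (n + 1), R) →ₗ[k] ⨂[k] _ : Fin n, R :=
  PiTensorProduct.lift <| MultilinearMap.mk'
    (fun r : Fin (n + 1) → R => PiTensorProduct.tprod k (mulAdjacent i r))
    (fun r j x y => by
      simp only [mulAdjacent_update, ← MultilinearMap.map_update_add]
      congr 2
      split_ifs <;> simp [add_mul, mul_add])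
    (fun r j c x => by
      simp only [mulAdjacent_update, ← MultilinearMap.map_update_smul]
      congr 2
      split_ifs <;> simp)

/-- The left action of `R` on `B`, as a `k`-linear map. -/
noncomputable def leftAct : R →ₗ[k] B →ₗ[k] B :=
  LinearMap.mk₂ k (fun r b => r • b) (fun _ _ _ => add_smul _ _ _) (fun c r b => smul_assoc c r b)
    (fun _ _ _ => smul_add _ _ _)
    (fun c r b => by
      rw [← algebraMap_smul R c b, ← algebraMap_smul R c (r • b), smul_smul, smul_smul,
        Algebra.commutes])

/-- The right action of `R` on `B`, as a `k`-linear map. -/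
noncomputable def rightAct : R →ₗ[k] B →ₗ[k] B :=
  (leftAct k Rᵐᵒᵖ B).comp (MulOpposite.opLinearEquiv k : R ≃ₗ[k] Rᵐᵒᵖ).toLinearMap

/-- The zeroth face map `b ⊗ r₁ ⊗ ⋯ ⊗ rₙ₊₁ ↦ b r₁ ⊗ r₂ ⊗ ⋯ ⊗ rₙ₊₁`. -/
noncomputable def faceFirst (n : ℕ) : Chains k R B (n + 1) →ₗ[k] Chains k R B n :=
  TensorProduct.lift <| LinearMap.flip <| PiTensorProduct.lift <| LinearMap.uncurryLeft <|
    LinearMap.mk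
      { toFun := fun r =>
          (((TensorProduct.mk k B (⨂[k] _ : Fin n, R)).comp (rightAct k R B r)).flip).compMultilinearMap
            (PiTensorProduct.tprod k)
        map_add' := fun x y => by
          ext; simp }
      (fun c x => by ext; simp [TensorProduct.smul_tmul'])

/-- The last face map `b ⊗ r₁ ⊗ ⋯ ⊗ rₙ₊₁ ↦ rₙ₊₁ b ⊗ r₁ ⊗ ⋯ ⊗ rₙ`. -/
noncomputable def faceLast (n : ℕ) : Chains k R B (n + 1) →ₗ[k] Chains k R B n :=
  TensorProduct.lift <| LinearMap.flip <| PiTensorProduct.lift <| MultilinearMap.uncurryRight <|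
    MultilinearMap.mk'
      (fun s : Fin n → R =>
        (LinearMap.llcomp k B B (Chains k R B n)
          ((TensorProduct.mk k B (⨂[k] _ : Fin n, R)).flip (PiTensorProduct.tprod k s))).comp
            (leftAct k R B))
      (fun s j x y => by ext; simp)
      (fun s j c x => by ext; simp)

/-- The face maps `∂₀, …, ∂ₙ₊₁` from `(n + 1)`-chains to `n`-chains. -/
noncomputable def face (n : ℕ) (i : Fin (n + 2)) : Chains k R B (n + 1) →ₗ[k] Chains k R B n :=
  Fin.cases (faceFirst k R B n)
    (Fin.lastCases (faceLast k R B n) (fun j => (mulAdjacentTensor k R j).lTensor B)) i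

/-- The Hochschild differential `∑ᵢ (-1)ⁱ ∂ᵢ`. -/
noncomputable def differential (n : ℕ) : Chains k R B (n + 1) →ₗ[k] Chains k R B n :=
  ∑ i : Fin (n + 2), (-1 : ℤ) ^ (i : ℕ) • face k R B n i

section Faces

variable {R B}

@[simp]
theorem face_zero_tmul_tprod (n : ℕ) (b : B) (r : Fin (n + 1) → R) :
    face k R B n 0 (b ⊗ₜ PiTensorProduct.tprod k r) =
      (MulOpposite.op (r 0) • b) ⊗ₜ PiTensorProduct.tprod k (Fin.tail r) := by
  simp [face, faceFirst, rightAct, leftAct]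

@[simp]
theorem face_last_tmul_tprod (n : ℕ) (b : B) (r : Fin (n + 1) → R) :
    face k R B n (Fin.last (n + 1)) (b ⊗ₜ PiTensorProduct.tprod k r) =
      (r (Fin.last n) • b) ⊗ₜ PiTensorProduct.tprod k (Fin.init r) := by
  rw [← Fin.succ_last, face, Fin.cases_succ, Fin.lastCases_last]
  simp [faceLast, leftAct]

@[simp]
theorem face_succ_castSucc_tmul_tprod (n : ℕ) (i : Fin n) (b : B) (r : Fin (n + 1) → R) :
    face k R B n i.castSucc.succ (b ⊗ₜ PiTensorProduct.tprod k r) =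
      b ⊗ₜ PiTensorProduct.tprod k (mulAdjacent i r) := by
  simp [face, mulAdjacentTensor]

/-- A uniform formula for all the face maps. -/
theorem face_tmul_tprod (n : ℕ) (i : Fin (n + 2)) (b : B) (r : Fin (n + 1) → R) :
    face k R B n i (b ⊗ₜ PiTensorProduct.tprod k r) =
      (if (i : ℕ) = 0 then MulOpposite.op (r 0) • b
        else if (i : ℕ) = n + 1 then r (Fin.last n) • b else b) ⊗ₜ
      PiTensorProduct.tprod k (fun l : Fin n =>
        if (l : ℕ) + 1 < i then r l.castSucc
        else if (l : ℕ) + 1 = i then r l.castSucc * r l.succ else r l.succ) := by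
  induction i using Fin.cases with
  | zero => simp; rfl
  | succ i =>
    induction i using Fin.lastCases with
    | last =>
      simp only [Fin.succ_last, face_last_tmul_tprod]
      simp; rfl
    | cast i =>
      have := i.isLt
      rw [face_succ_castSucc_tmul_tprod]
      simp only [Fin.val_succ, Fin.val_castSucc, Nat.add_lt_add_iff_right, Nat.add_right_cancel_iff]
      rw [if_neg (by omega), if_neg (by omega)]
      congr 2
      funext l
      simp only [mulAdjacent, Fin.lt_def, Fin.ext_iff]

variable [SMulCommClass R Rᵐᵒᵖ B]

/-- The simplicial identity `∂ᵢ ∂ⱼ₊₁ = ∂ⱼ ∂ᵢ` for `i ≤ j`. -/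
theorem face_comp_face (n : ℕ) (i j : Fin (n + 2)) (hij : i ≤ j) :
    (face k R B n i).comp (face k R B (n + 1) j.succ) =
      (face k R B n j).comp (face k R B (n + 1) i.castSucc) := by
  have hi := i.isLt
  have hj := j.isLt
  rw [Fin.le_def] at hij
  ext b r
  simp only [TensorProduct.AlgebraTensorModule.curry_apply, TensorProduct.curry_apply,
    LinearMap.compMultilinearMap_apply, LinearMap.coe_restrictScalars, LinearMap.comp_apply,
    face_tmul_tprod, Fin.val_succ, Fin.val_castSucc]
  congr 1
  · have e1 : ¬ ((j : ℕ) + 1 = 0) := by omega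
    have e2 : ¬ ((i : ℕ) = n + 1 + 1) := by omega
    have e3 : ((j : ℕ) + 1 = n + 1 + 1) ↔ (j : ℕ) = n + 1 := by omega
    simp only [Fin.val_zero, Fin.val_last, e1, e2, e3, if_false]
    by_cases h1 : (i : ℕ) = 0 <;> by_cases h2 : (j : ℕ) = n + 1 <;> by_cases h3 : (j : ℕ) = 0
    all_goals try omega
    all_goals simp only [h1, h2, h3, if_true, if_false]
    · rw [if_pos (by omega), if_neg (by omega), if_neg (by omega), if_neg (by omega)]
      exact (smul_comm _ _ _).symm
    · rw [if_neg (by omega), if_neg (by omega), if_neg (by omega), if_neg (by omega), smul_smul,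
        ← MulOpposite.op_mul]
      rfl
    · exact congrArg (fun t => MulOpposite.op t • b)
        (if_pos (show 0 + 1 < (j : ℕ) + 1 by omega))
    · have e4 : ¬ (n + 1 = 0) := by omega
      have e5 : ¬ (n + 1 < (i : ℕ)) := by omega
      have e6 : n + 1 < n + 1 + 1 := by omega
      by_cases h4 : (i : ℕ) = n + 1
      · simp only [h4, e4, e6, lt_irrefl, if_true, if_false, smul_smul]
        rfl
      · simp only [h4, Ne.symm h4, e4, e5, if_false]
        rfl
    · rw [if_neg (by omega)]
  · congr 1
    funext l
    have hl := l.isLt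
    split_ifs <;> first | rfl | omega | (simp [mul_assoc])

end Faces

variable [SMulCommClass R Rᵐᵒᵖ B]

theorem differential_comp_differential (n : ℕ) :
    (differential k R B n).comp (differential k R B (n + 1)) = 0 := by
  refine LinearMap.ext fun x => ?_
  simp only [differential, LinearMap.comp_apply, LinearMap.sum_apply, LinearMap.smul_apply,
    map_sum, map_zsmul, LinearMap.zero_apply, Finset.smul_sum]
  rw [Finset.sum_comm, ← Finset.sum_product']
  let P := Fin (n + 2) × Fin (n + 3)
  let S : Finset P := {ij : P | (ij.2 : ℕ) ≤ (ij.1 : ℕ)}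
  rw [Finset.univ_product_univ, ← Finset.sum_add_sum_compl S, ← eq_neg_iff_add_eq_zero,
    ← Finset.sum_neg_distrib]
  let φ : ∀ ij : P, ij ∈ S → P := fun ij hij =>
    (Fin.castLT ij.2 (lt_of_le_of_lt (Finset.mem_filter.mp hij).right (Fin.is_lt ij.1)), ij.1.succ)
  apply Finset.sum_bij φ
  · intro ij hij
    simp_rw [S, φ, Finset.compl_filter, Finset.mem_filter_univ, Fin.val_succ,
      Fin.val_castLT] at hij ⊢
    lia
  · rintro ⟨i, j⟩ hij ⟨i', j'⟩ hij' h
    rw [Prod.mk_inj]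
    exact ⟨by simpa [φ] using! congr_arg Prod.snd h,
      by simpa [φ, Fin.castSucc_castLT] using! congr_arg Fin.castSucc (congr_arg Prod.fst h)⟩
  · rintro ⟨i', j'⟩ hij'
    simp_rw [S, Finset.compl_filter, Finset.mem_filter_univ, not_le] at hij'
    refine ⟨(j'.pred <| ?_, Fin.castSucc i'), ?_, ?_⟩
    · rintro rfl
      simp only [Fin.val_zero, not_lt_zero] at hij'
    · simpa [S] using! Nat.le_sub_one_of_lt hij'
    · simp only [φ, Fin.castLT_castSucc, Fin.succ_pred]
  · rintro ⟨i, j⟩ hij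
    have h := face_comp_face k (R := R) (B := B) n
      (Fin.castLT j (lt_of_le_of_lt (Finset.mem_filter.mp hij).right i.isLt)) i
      (Finset.mem_filter.mp hij).right
    rw [Fin.castSucc_castLT] at h
    have hx := LinearMap.congr_fun h x
    simp only [LinearMap.comp_apply] at hx
    simp only [smul_smul, ← neg_smul]
    rw [hx]
    congr 1
    simp only [φ, Fin.val_succ, Fin.val_castLT, pow_add, pow_one, mul_neg, mul_one]
    ring

/-- The Hochschild complex `C_•(R, B)`: the chain complex of `k`-modules with
`C_n(R, B) = B ⊗ R^{⊗ n}` and the differential `∑ᵢ (-1)ⁱ ∂ᵢ`. -/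
noncomputable def complex : ChainComplex (ModuleCat k) ℕ :=
  ChainComplex.of (fun n => ModuleCat.of k (Chains k R B n))
    (fun n => ModuleCat.ofHom (differential k R B n))
    (fun n => by
      rw [← ModuleCat.ofHom_comp, differential_comp_differential]; rfl)

theorem complex_d (n : ℕ) :
    (complex k R B).d (n + 1) n = ModuleCat.ofHom (differential k R B n) :=
  ChainComplex.of_d (fun n => ModuleCat.of k (Chains k R B n))
    (fun n => ModuleCat.ofHom (differential k R B n)) n

/-- The Hochschild homology `H_i(R, B)` over `k`. -/
noncomputable abbrev homology (i : ℕ) : ModuleCat k := (complex k R B).homology i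

/-- The canonical map `B = C_0(R, B) → H_0(R, B)` sending `b` to the class of the
`0`-cycle `b`. -/
noncomputable def classZero : B →ₗ[k] homology k R B 0 :=
  ((complex k R B).liftCycles (𝟙 ((complex k R B).X 0)) 0 (by simp)
      (by simp) ≫ (complex k R B).homologyπ 0).hom.comp
    ((TensorProduct.mk k B (⨂[k] _ : Fin 0, R)).flip (PiTensorProduct.tprod k Fin.elim0))

end Complex

end Hochschild

section Frobenius

variable (p n : ℕ) [Fact p.Prime] (A : Type u) [CommRing A] [Algebra (ZMod p) A]

/-- The `p ^ n`-th power map `a ↦ a ^ (p ^ n)` of a commutative `𝔽_p`-algebra. -/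
def powFrobenius : A →ₐ[ZMod p] A where
  toFun a := a ^ p ^ n
  map_one' := one_pow _
  map_mul' _ _ := mul_pow _ _ _
  map_zero' := zero_pow (pow_ne_zero _ (Fact.out : p.Prime).ne_zero)
  map_add' a b := by
    cases subsingleton_or_nontrivial A
    · exact Subsingleton.elim _ _
    · have : CharP A p := charP_of_injective_algebraMap (algebraMap (ZMod p) A).injective p
      exact add_pow_char_pow a b p n
  commutes' c := by rw [← map_pow, ZMod.pow_card_pow]

/-- The `A`-`A`-bimodule `Φⁿ(A)`: it is `A` as a left `A`-module, and the right action is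
`m a = a ^ (p ^ n) m`. -/
def FrobeniusTwist (_p _n : ℕ) (A : Type u) : Type u := A

namespace FrobeniusTwist

instance : AddCommGroup (FrobeniusTwist p n A) := inferInstanceAs (AddCommGroup A)

instance : Module (ZMod p) (FrobeniusTwist p n A) := inferInstanceAs (Module (ZMod p) A)

/-- The left action is the multiplication of `A`. -/
instance : Module A (FrobeniusTwist p n A) := inferInstanceAs (Module A A)

/-- The right action is `m a = a ^ (p ^ n) m`. -/
instance : Module Aᵐᵒᵖ (FrobeniusTwist p n A) :=
  Module.compHom A ((powFrobenius p n A : A →+* A).comp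
    ((RingEquiv.toOpposite A).symm : Aᵐᵒᵖ →+* A))

/-- The identity map from `A` to the underlying module of `Φⁿ(A)`. -/
def of : A ≃ₗ[A] FrobeniusTwist p n A := LinearEquiv.refl A A

theorem op_smul_of (a m : A) : MulOpposite.op a • of p n A m = of p n A (a ^ p ^ n * m) := rfl

instance : IsScalarTower (ZMod p) A (FrobeniusTwist p n A) :=
  inferInstanceAs (IsScalarTower (ZMod p) A A)

instance : IsScalarTower (ZMod p) Aᵐᵒᵖ (FrobeniusTwist p n A) where
  smul_assoc c a m := by
    change powFrobenius p n A (c • a.unop) * (show A from m) =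
      c • (powFrobenius p n A a.unop * (show A from m))
    rw [map_smul, smul_mul_assoc]

instance : SMulCommClass A Aᵐᵒᵖ (FrobeniusTwist p n A) where
  smul_comm a b m := mul_left_comm a (powFrobenius p n A b.unop) (show A from m)

end FrobeniusTwist

/-- The quotient ring `ψⁿ(A)` of `A` by the ideal generated by all `a - a ^ (p ^ n)`. -/
abbrev FrobeniusCoinvariants (p n : ℕ) (A : Type u) [CommRing A] : Type u :=
  A ⧸ Ideal.span (Set.range fun a : A => a - a ^ p ^ n)

end Frobenius

/-!
The Hochschild chains `Φⁿ(A) ⊗ A^{⊗ m}` form a simplicial commutative `𝔽_p`-algebra: written as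
`A^{⊗ (m + 1)}`, all their faces are ring homomorphisms, the right action of `r` on `Φⁿ(A)` being
the multiplication by `F r`, where `F a = a ^ q` and `q = p ^ n`. The vanishing in positive degrees
is obtained by computing the `q`-th power map on the homology of this object in two ways.

* It is the identity. The rotation `t` of the tensor factors, with `F` applied once to each factor
  that passes through the coefficients, satisfies `t ^ (m + 1) = F ⊗ ⋯ ⊗ F` in degree `m`, and this
  is the `q`-th power map of the ring `A^{⊗ (m + 1)}`. On elements with vanishing faces, `t` is
  homologous to the identity up to the sign `(-1) ^ m` (`ParacyclicRing.D_t_s`), and the signs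
  cancel in `t ^ (m + 1)`.
* It is zero. In a simplicial commutative ring the product of two elements of positive degree with
  vanishing faces is a boundary (`ParacyclicRing.D_mul`), and `y ^ q = y * y ^ (q - 1)`.

Every cycle of positive degree is homologous to one with vanishing faces
(`ParacyclicRing.exists_faces_eq_zero`), so that the complex is exact there
(`ParacyclicRing.exact_of_iterate_t_eq_pow`). In degree zero the image of the differential is
spanned by the elements `a ^ q * b - a * b`, that is, it is the ideal generated by all `a - a ^ q`
(`Hochschild.classZero_of_eq_zero_iff`).

The tensor factors are numbered in the reverse of the order in the Hochschild complex, because the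
indices of the factors, taken modulo the number of factors and with each wrap-around recorded as an
application of `F`, then turn the faces, the degeneracies and the rotation into simple maps of
natural numbers.
-/

/-! ### Simplicial commutative rings with a cyclic operator -/

/-- A simplicial commutative ring `X` with a cyclic operator `t` in each degree, of possibly
infinite order. The faces `d m k` and degeneracies `s m k` are indexed by natural numbers `k`; they
are meaningful only for `k ≤ m + 1` and `k ≤ m`, respectively, and only those simplicial and cyclic
identities are included which the proof of exactness needs. -/
structure ParacyclicRing where
  X : ℕ → Type u
  [commRing : ∀ m, CommRing (X m)]
  d (m k : ℕ) : X (m + 1) →+* X m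
  s (m k : ℕ) : X m →+* X (m + 1)
  t (m : ℕ) : X m →+* X m
  d_d (m i j : ℕ) (hij : i ≤ j) (hj : j ≤ m + 1) (x : X (m + 2)) :
    d m i (d (m + 1) (j + 1) x) = d m j (d (m + 1) i x)
  d_s_of_le (m i j : ℕ) (hij : i ≤ j) (hj : j ≤ m) (x : X (m + 1)) :
    d (m + 1) i (s (m + 1) (j + 1) x) = s m j (d m i x)
  d_s_self (m k : ℕ) (hk : k ≤ m) (x : X m) : d m k (s m k x) = x
  d_succ_s (m k : ℕ) (hk : k ≤ m) (x : X m) : d m (k + 1) (s m k x) = x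
  d_s_of_lt (m i j : ℕ) (hij : j < i) (hi : i ≤ m + 1) (x : X (m + 1)) :
    d (m + 1) (i + 1) (s (m + 1) j x) = s m j (d m i x)
  d_zero_t (m : ℕ) (x : X (m + 1)) : d m 0 (t (m + 1) x) = d m (m + 1) x
  d_succ_t (m k : ℕ) (hk : k ≤ m) (x : X (m + 1)) : d m (k + 1) (t (m + 1) x) = t m (d m k x)

namespace ParacyclicRing

attribute [instance] commRing

variable (P : ParacyclicRing.{u})

/-- The alternating sum of the faces. -/
def D (m : ℕ) : P.X (m + 1) →+ P.X m :=
  ∑ k ∈ Finset.range (m + 2), (-1 : ℤ) ^ k • (P.d m k).toAddMonoidHom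

theorem D_apply (m : ℕ) (x : P.X (m + 1)) :
    P.D m x = ∑ k ∈ Finset.range (m + 2), (-1 : ℤ) ^ k • P.d m k x := by
  simp [D]

/-- The alternating sum with the signs written as factors in the ring. This form involves no
action of `ℤ`, for which tensor powers have several instances. -/
theorem D_apply_eq_sum_mul (m : ℕ) (x : P.X (m + 1)) :
    P.D m x = ∑ k ∈ Finset.range (m + 2), (-1) ^ k * P.d m k x := by
  simp [D_apply]

theorem D_D (m : ℕ) (x : P.X (m + 2)) : P.D m (P.D (m + 1) x) = 0 := by
  simp only [D_apply, map_sum, map_zsmul, Finset.smul_sum, smul_smul]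
  rw [← Finset.sum_product']
  -- The terms of index `(j + 1, i)` and `(i, j)` with `i ≤ j` cancel.
  refine Finset.sum_involution
    (fun ij _ => if ij.2 < ij.1 then (ij.2, ij.1 - 1) else (ij.2 + 1, ij.1)) ?_ ?_ ?_ ?_
  · rintro ⟨j, i⟩ h
    simp only [Finset.mem_product, Finset.mem_range] at h
    by_cases hij : i < j
    · obtain ⟨j, rfl⟩ : ∃ l, j = l + 1 := ⟨j - 1, by omega⟩
      simp only [hij, if_true, Nat.add_sub_cancel]
      rw [P.d_d m i j (by omega) (by omega), ← add_smul]
      simp [pow_succ, mul_comm]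
    · simp only [hij, if_false]
      rw [P.d_d m j i (by omega) (by omega), ← add_smul]
      simp [pow_succ, mul_comm]
  · rintro ⟨j, i⟩ h -
    dsimp only
    split_ifs with hij <;> simp only [ne_eq, Prod.mk.injEq] <;> omega
  · rintro ⟨j, i⟩ h
    simp only [Finset.mem_product, Finset.mem_range] at h
    dsimp only
    split_ifs with hij <;> simp only [Finset.mem_product, Finset.mem_range] <;> omega
  · rintro ⟨j, i⟩ h
    by_cases hij : i < j
    · simp only [hij, if_true, if_neg (show ¬ j - 1 < i by omega), Prod.mk.injEq, and_true]
      omega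
    · simp only [hij, if_false, if_pos (show j < i + 1 by omega), Nat.add_sub_cancel]

variable {P} in
/-- Removing the `j`-th face of a cycle whose faces above `j` vanish changes the cycle by a
boundary, namely by that of `± sⱼ x`. -/
theorem D_s_of_D_eq_zero {m j : ℕ} (hj : j ≤ m) {x : P.X (m + 1)} (hx : P.D m x = 0)
    (h : ∀ i, j + 1 < i → i ≤ m + 1 → P.d m i x = 0) :
    P.D (m + 1) ((-1 : ℤ) ^ j • P.s (m + 1) (j + 1) x) = P.s m j (P.d m (j + 1) x) := by
  have hcyc : ∑ i ∈ Finset.range (j + 1), (-1 : ℤ) ^ i • P.d m i x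
      = (-1 : ℤ) ^ j • P.d m (j + 1) x := by
    have h2 : ∑ i ∈ Finset.range (j + 2), (-1 : ℤ) ^ i • P.d m i x = 0 := by
      rw [← hx, D_apply]
      refine Finset.sum_subset (Finset.range_subset_range.2 (by omega)) fun i hi hi' => ?_
      simp only [Finset.mem_range] at hi hi'
      rw [h i (by omega) (by omega), smul_zero]
    rw [Finset.sum_range_succ] at h2
    rw [eq_neg_of_add_eq_zero_left h2, pow_succ, mul_neg_one, neg_smul, neg_neg]
  have hsum : P.D (m + 1) (P.s (m + 1) (j + 1) x)
      = ∑ i ∈ Finset.range (j + 1), (-1 : ℤ) ^ i • P.s m j (P.d m i x) := by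
    have h3 : ∑ i ∈ Finset.range (j + 3), (-1 : ℤ) ^ i • P.d (m + 1) i (P.s (m + 1) (j + 1) x)
        = ∑ i ∈ Finset.range (j + 1), (-1 : ℤ) ^ i • P.s m j (P.d m i x) := by
      rw [Finset.sum_range_succ, Finset.sum_range_succ, P.d_s_self _ _ (by omega),
        P.d_succ_s _ _ (by omega), add_assoc, ← add_smul, pow_succ _ (j + 1), mul_neg_one,
        add_neg_cancel, zero_smul, add_zero]
      refine Finset.sum_congr rfl fun i hi => ?_
      rw [P.d_s_of_le m i j (by simpa [Nat.lt_succ_iff] using hi) hj]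
    rw [← h3, D_apply]
    refine (Finset.sum_subset (Finset.range_subset_range.2 (by omega)) fun i hi hi' => ?_).symm
    simp only [Finset.mem_range] at hi hi'
    obtain ⟨i, rfl⟩ : ∃ l, i = l + 1 := ⟨i - 1, by omega⟩
    rw [P.d_s_of_lt m i (j + 1) (by omega) (by omega), h i (by omega) (by omega), map_zero,
      smul_zero]
  have h4 := congrArg (P.s m j) hcyc
  simp only [map_sum, map_zsmul] at h4
  rw [map_zsmul, hsum, h4, smul_smul, ← mul_pow]
  simp

variable {P} in
/-- Every cycle of positive degree is homologous to one all of whose faces vanish. -/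
theorem exists_faces_eq_zero {m : ℕ} {x : P.X (m + 1)} (hx : P.D m x = 0) :
    ∃ w, ∀ k ≤ m + 1, P.d m k (x - P.D (m + 1) w) = 0 := by
  have key : ∀ l ≤ m + 1, ∃ w, ∀ k, m + 1 - l < k → k ≤ m + 1 →
      P.d m k (x - P.D (m + 1) w) = 0 := by
    intro l
    induction l with
    | zero => exact fun _ => ⟨0, fun k h1 h2 => by omega⟩
    | succ l ih =>
      intro hl
      obtain ⟨w, hw⟩ := ih (by omega)
      obtain ⟨j, hj, hjm⟩ : ∃ j, m + 1 - l = j + 1 ∧ j ≤ m := ⟨m - l, by omega, by omega⟩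
      rw [hj] at hw
      set x' := x - P.D (m + 1) w with hx'
      have hD : P.D m x' = 0 := by rw [hx', map_sub, hx, D_D, sub_zero]
      refine ⟨w + (-1 : ℤ) ^ j • P.s (m + 1) (j + 1) x', fun k hk hkm => ?_⟩
      rw [map_add, ← sub_sub, ← hx', D_s_of_D_eq_zero hjm hD hw, map_sub, sub_eq_zero]
      obtain rfl | hk' : k = j + 1 ∨ j + 1 < k := by omega
      · rw [P.d_succ_s m j hjm]
      · rw [hw k hk' hkm]
        obtain ⟨m, rfl⟩ : ∃ m', m = m' + 1 := ⟨m - 1, by omega⟩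
        obtain ⟨k, rfl⟩ : ∃ k', k = k' + 1 := ⟨k - 1, by omega⟩
        rw [P.d_s_of_lt m k j (by omega) (by omega), ← P.d_d m (j + 1) k (by omega) (by omega),
          hw (k + 1) hk' hkm, map_zero, map_zero]
  obtain ⟨w, hw⟩ := key (m + 1) le_rfl
  refine ⟨w, fun k hk => ?_⟩
  obtain rfl | hk' := Nat.eq_zero_or_pos k
  · -- The zeroth face is the only one left in the alternating sum, which vanishes.
    have hD : P.D m (x - P.D (m + 1) w) = 0 := by rw [map_sub, hx, D_D, sub_zero]
    rw [D_apply, Finset.sum_eq_single 0] at hD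
    · simpa using hD
    · intro k hk hk0
      rw [Finset.mem_range] at hk
      rw [hw k (by omega) (by omega), smul_zero]
    · simp
  · exact hw k (by omega) hk

variable {P} in
/-- An Eckmann–Hilton argument: the product of two elements of positive degree with vanishing
faces is a boundary, since `s₀ y * s₁ z` has only one nonzero face. -/
theorem D_mul {m : ℕ} {y z : P.X (m + 1)} (hy : ∀ k ≤ m + 1, P.d m k y = 0)
    (hz : ∀ k ≤ m + 1, P.d m k z = 0) :
    P.D (m + 1) (P.s (m + 1) 0 y * P.s (m + 1) 1 z) = -(y * z) := by
  rw [D_apply, Finset.sum_eq_single 1]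
  · rw [map_mul, P.d_succ_s _ 0 (by omega), P.d_s_self _ 1 (by omega)]
    simp
  · intro k hk hk1
    rw [Finset.mem_range] at hk
    rw [map_mul]
    obtain rfl | hk' : k = 0 ∨ 2 ≤ k := by omega
    · rw [P.d_s_of_le m 0 0 le_rfl (by omega) z, hz 0 (by omega), map_zero, mul_zero, smul_zero]
    · obtain ⟨k, rfl⟩ : ∃ k', k = k' + 1 := ⟨k - 1, by omega⟩
      rw [P.d_s_of_lt m k 0 (by omega) (by omega), hy k (by omega), map_zero, zero_mul, smul_zero]
  · simp

variable {P} in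
/-- On elements with vanishing faces the cyclic operator is, up to the sign of a cyclic permutation,
homologous to the identity: the boundary of `t (sₘ y)` has only two nonzero terms. -/
theorem D_t_s {m : ℕ} {y : P.X (m + 1)} (hy : ∀ k ≤ m + 1, P.d m k y = 0) :
    P.D (m + 1) (P.t (m + 2) (P.s (m + 1) (m + 1) y)) =
      y - (-1 : ℤ) ^ (m + 1) • P.t (m + 1) y := by
  rw [D_apply, Finset.sum_range_succ', Finset.sum_range_succ, P.d_zero_t,
    P.d_succ_s _ _ le_rfl, P.d_succ_t _ _ le_rfl, P.d_s_self _ _ le_rfl, Finset.sum_eq_zero]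
  · rw [pow_succ _ (m + 1), mul_neg_one, neg_smul, pow_zero, one_smul, zero_add, neg_add_eq_sub]
  · intro k hk
    have hk : k ≤ m := by simpa [Nat.lt_succ_iff] using hk
    rw [P.d_succ_t _ _ (by omega), P.d_s_of_le m k m hk le_rfl, hy k (by omega), map_zero, map_zero,
      smul_zero]

variable {P} in
theorem d_t_eq_zero {m : ℕ} {y : P.X (m + 1)} (hy : ∀ k ≤ m + 1, P.d m k y = 0) :
    ∀ k ≤ m + 1, P.d m k (P.t (m + 1) y) = 0
  | 0, _ => by rw [P.d_zero_t, hy _ le_rfl]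
  | k + 1, hk => by rw [P.d_succ_t _ _ (by omega), hy k (by omega), map_zero]

variable {P} in
theorem sub_iterate_t_mem_range_D {m : ℕ} {y : P.X (m + 1)} (hy : ∀ k ≤ m + 1, P.d m k y = 0)
    (j : ℕ) : y - (-1 : ℤ) ^ ((m + 1) * j) • (P.t (m + 1))^[j] y ∈ (P.D (m + 1)).range := by
  induction j generalizing y with
  | zero => simp
  | succ j ih =>
    have h1 := ih (d_t_eq_zero hy)
    have h2 : y - (-1 : ℤ) ^ (m + 1) • P.t (m + 1) y ∈ (P.D (m + 1)).range := ⟨_, D_t_s hy⟩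
    have h3 := add_mem h2 (AddSubgroup.zsmul_mem _ h1 ((-1 : ℤ) ^ (m + 1)))
    rw [smul_sub, smul_smul, ← pow_add, sub_add_sub_cancel] at h3
    rwa [Function.iterate_succ_apply, mul_add_one, add_comm _ (m + 1)]

/-- If the `(m + 1)`-st power of the cyclic operator on `X m` is a power map with exponent at least
`2`, then the alternating face map complex of `X` is exact in positive degrees. -/
theorem exact_of_iterate_t_eq_pow {q : ℕ} (hq : 2 ≤ q)
    (ht : ∀ m (x : P.X m), (P.t m)^[m + 1] x = x ^ q) {m : ℕ} {x : P.X (m + 1)}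
    (hx : P.D m x = 0) : ∃ w, P.D (m + 1) w = x := by
  obtain ⟨w, hw⟩ := exists_faces_eq_zero hx
  set y := x - P.D (m + 1) w with hy
  have h1 : y - y ^ q ∈ (P.D (m + 1)).range := by
    have h := sub_iterate_t_mem_range_D hw (m + 2)
    rwa [ht, Even.neg_one_pow (Nat.even_mul_succ_self (m + 1)), one_smul] at h
  have h2 : y ^ q ∈ (P.D (m + 1)).range := by
    obtain ⟨r, rfl⟩ : ∃ r, q = r + 2 := ⟨q - 2, by omega⟩
    rw [pow_succ' y (r + 1), ← neg_mem_iff]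
    exact ⟨_, D_mul hw fun k hk => by rw [map_pow, hw k hk, zero_pow (by omega)]⟩
  have h3 := add_mem (add_mem h1 h2) (⟨w, rfl⟩ : P.D (m + 1) w ∈ (P.D (m + 1)).range)
  rw [sub_add_cancel, hy, sub_add_cancel] at h3
  exact h3

end ParacyclicRing

/-! ### Tensor powers of a commutative algebra with an endomorphism -/

namespace TwistedTensorPower

section

variable {k : Type v} [CommRing k] {A : Type u} [CommRing A] [Algebra k A] (F : A →ₐ[k] A)

/-- The inclusion of `A` in slot `c` of `A^{⊗ (m + 1)}`. The slots are indexed by all natural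
numbers, slot `c + (m + 1)` being slot `c` precomposed with the endomorphism `F`. -/
noncomputable def slot (m c : ℕ) : A →ₐ[k] ⨂[k] _ : Fin (m + 1), A :=
  (PiTensorProduct.singleAlgHom (⟨c % (m + 1), Nat.mod_lt c m.succ_pos⟩ : Fin (m + 1))).comp
    (F ^ (c / (m + 1)))

theorem slot_fin (m : ℕ) (c : Fin (m + 1)) :
    slot F m c = PiTensorProduct.singleAlgHom (R := k) (A := fun _ => A) c := by
  have h : (⟨(c : ℕ) % (m + 1), Nat.mod_lt _ m.succ_pos⟩ : Fin (m + 1)) = c :=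
    Fin.ext (Nat.mod_eq_of_lt c.isLt)
  rw [slot, h, Nat.div_eq_of_lt c.isLt, pow_zero]
  rfl

theorem slot_add (m c : ℕ) (a : A) : slot F m (c + (m + 1)) a = slot F m c (F a) := by
  have h : (⟨(c + (m + 1)) % (m + 1), Nat.mod_lt _ m.succ_pos⟩ : Fin (m + 1)) =
    ⟨c % (m + 1), Nat.mod_lt _ m.succ_pos⟩ := Fin.ext (Nat.add_mod_right _ _)
  simp only [slot, h, Nat.add_div_right c m.succ_pos, Nat.succ_eq_add_one, pow_succ]
  rfl

theorem slot_self (m : ℕ) (a : A) : slot F m (m + 1) a = slot F m 0 (F a) := by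
  rw [← slot_add, zero_add]

theorem tprod_eq_prod_slot (m : ℕ) (x : Fin (m + 1) → A) :
    PiTensorProduct.tprod k x = ∏ c : Fin (m + 1), slot F m c (x c) := by
  simp only [slot_fin, PiTensorProduct.singleAlgHom_apply, ← PiTensorProduct.tprod_prod]
  congr 1
  exact (Finset.univ_prod_mulSingle x).symm

theorem algHom_ext_slot {S : Type*} [Semiring S] [Algebra k S] {m : ℕ}
    {f g : (⨂[k] _ : Fin (m + 1), A) →ₐ[k] S}
    (h : ∀ c ≤ m, ∀ a, f (slot F m c a) = g (slot F m c a)) : f = g := by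
  refine PiTensorProduct.algHom_ext fun c => AlgHom.ext fun a => ?_
  rw [← slot_fin F]
  exact h c (Nat.lt_succ_iff.1 c.isLt) a

/-- The algebra homomorphism that takes slot `c` to slot `f c`, for `c ≤ m`. -/
noncomputable def relabel (m l : ℕ) (f : ℕ → ℕ) :
    (⨂[k] _ : Fin (m + 1), A) →ₐ[k] ⨂[k] _ : Fin (l + 1), A :=
  PiTensorProduct.liftAlgHom
    ((MultilinearMap.mkPiAlgebra k (Fin (m + 1)) (⨂[k] _ : Fin (l + 1), A)).compLinearMap
      fun c => (slot F l (f c)).toLinearMap)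
    (by simp) (fun x y => by simp [Finset.prod_mul_distrib])

theorem relabel_tprod (m l : ℕ) (f : ℕ → ℕ) (x : Fin (m + 1) → A) :
    relabel F m l f (PiTensorProduct.tprod k x) = ∏ c : Fin (m + 1), slot F l (f c) (x c) := by
  refine (PiTensorProduct.lift.tprod x).trans ?_
  simp

theorem relabel_slot (m l : ℕ) (f : ℕ → ℕ) {c : ℕ} (hc : c ≤ m) (a : A) :
    relabel F m l f (slot F m c a) = slot F l (f c) a := by
  obtain ⟨c, rfl⟩ : ∃ c' : Fin (m + 1), (c' : ℕ) = c := ⟨⟨c, Nat.lt_succ_iff.2 hc⟩, rfl⟩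
  rw [slot_fin, PiTensorProduct.singleAlgHom_apply, relabel_tprod,
    Finset.prod_eq_single c]
  · simp
  · intro b _ hb
    simp [Pi.mulSingle_eq_of_ne hb]
  · simp

/-- The formula for `relabel` holds for one more slot if `f` is compatible with the wrap-around. -/
theorem relabel_slot_of_le_succ (m l : ℕ) (f : ℕ → ℕ) (hf : f (m + 1) = f 0 + (l + 1)) {c : ℕ}
    (hc : c ≤ m + 1) (a : A) : relabel F m l f (slot F m c a) = slot F l (f c) a := by
  obtain hc | rfl := Nat.le_succ_iff.1 hc
  · exact relabel_slot F m l f hc a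
  · rw [slot_self, relabel_slot F m l f (Nat.zero_le m), hf, slot_add]

/-- The `i`-th face, for `i ≤ m + 1`: the slots `i` and `i + 1` are multiplied, and the later slots
move down by one. The last face takes slot `m + 1` to slot `m + 1` of `A^{⊗ (m + 1)}`, which is slot
`0` twisted by `F`, so that it multiplies slot `0` by the image under `F` of slot `m + 1`. -/
noncomputable def face (m i : ℕ) :
    (⨂[k] _ : Fin (m + 1 + 1), A) →ₐ[k] ⨂[k] _ : Fin (m + 1), A :=
  relabel F (m + 1) m fun c => if c ≤ i then c else c - 1

theorem face_slot (m i : ℕ) (hi : i ≤ m + 1) {c : ℕ} (hc : c ≤ m + 2) (a : A) :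
    face F m i (slot F (m + 1) c a) = slot F m (if c ≤ i then c else c - 1) a :=
  relabel_slot_of_le_succ F _ _ _ (by simp [show ¬ m + 1 + 1 ≤ i by omega]) hc a

/-- The `i`-th degeneracy, for `i ≤ m`, inserts a unit after slot `i`. -/
noncomputable def degeneracy (m i : ℕ) :
    (⨂[k] _ : Fin (m + 1), A) →ₐ[k] ⨂[k] _ : Fin (m + 1 + 1), A :=
  relabel F m (m + 1) fun c => if c ≤ i then c else c + 1

theorem degeneracy_slot (m i : ℕ) (hi : i ≤ m) {c : ℕ} (hc : c ≤ m + 1) (a : A) :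
    degeneracy F m i (slot F m c a) = slot F (m + 1) (if c ≤ i then c else c + 1) a :=
  relabel_slot_of_le_succ F _ _ _ (by simp [show ¬ m + 1 ≤ i by omega]) hc a

/-- The cyclic operator shifts all the slots by one; the last slot becomes slot `m + 1`, that is,
slot `0` twisted by `F`. -/
noncomputable def cyclic (m : ℕ) :
    (⨂[k] _ : Fin (m + 1), A) →ₐ[k] ⨂[k] _ : Fin (m + 1), A :=
  relabel F m m fun c => c + 1

theorem cyclic_slot (m c : ℕ) (hc : c ≤ m + 1) (a : A) :
    cyclic F m (slot F m c a) = slot F m (c + 1) a :=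
  relabel_slot_of_le_succ F _ _ _ (by omega) hc a

/-- The cyclic operator to the power of the number of slots is the endomorphism `G` induced by `F`
on the tensor power. -/
theorem iterate_cyclic (m : ℕ) (G : (⨂[k] _ : Fin (m + 1), A) →ₐ[k] ⨂[k] _ : Fin (m + 1), A)
    (hG : ∀ c a, G (slot F m c a) = slot F m c (F a)) (x : ⨂[k] _ : Fin (m + 1), A) :
    (cyclic F m)^[m + 1] x = G x := by
  have hall : ∀ c a, cyclic F m (slot F m c a) = slot F m (c + 1) a := by
    intro c
    induction c using Nat.strong_induction_on with
    | _ c ih =>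
      intro a
      by_cases hc : c ≤ m + 1
      · exact cyclic_slot F m c hc a
      · obtain ⟨c, rfl⟩ : ∃ c', c = c' + (m + 1) := ⟨c - (m + 1), by omega⟩
        rw [slot_add, ih c (by omega), ← slot_add, add_right_comm]
  have hpow : ∀ j c a, (cyclic F m ^ j) (slot F m c a) = slot F m (c + j) a := by
    intro j
    induction j with
    | zero => exact fun c a => rfl
    | succ j ih =>
      intro c a
      rw [pow_succ, AlgHom.mul_apply, hall, ih, add_right_comm, add_assoc]
  have h : cyclic F m ^ (m + 1) = G :=
    algHom_ext_slot F fun c _ a => by rw [hpow, hG, slot_add]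
  rw [← h, AlgHom.coe_pow]

variable (k A) in
/-- The tensor powers of `A` as a simplicial commutative ring with a cyclic operator: the cyclic
bar construction of `A` with coefficients twisted by `F`. -/
noncomputable def paracyclicRing : ParacyclicRing where
  X m := ⨂[k] _ : Fin (m + 1), A
  d m i := face F m i
  s m i := degeneracy F m i
  t m := cyclic F m
  d_d m i j hij hj x := by
    refine DFunLike.congr_fun (f := (face F m i).comp (face F (m + 1) (j + 1)))
      (g := (face F m j).comp (face F (m + 1) i)) (algHom_ext_slot F fun c hc a => ?_) x
    simp only [AlgHom.comp_apply]
    rw [face_slot _ _ _ (by omega) (by omega),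
      face_slot _ _ _ (by omega) (by split_ifs <;> omega),
      face_slot _ _ _ (by omega) (by omega),
      face_slot _ _ _ (by omega) (by split_ifs <;> omega)]
    congr 2
    split_ifs <;> omega
  d_s_of_le m i j hij hj x := by
    refine DFunLike.congr_fun (f := (face F (m + 1) i).comp (degeneracy F (m + 1) (j + 1)))
      (g := (degeneracy F m j).comp (face F m i)) (algHom_ext_slot F fun c hc a => ?_) x
    simp only [AlgHom.comp_apply]
    rw [degeneracy_slot _ _ _ (by omega) (by omega),
      face_slot _ _ _ (by omega) (by split_ifs <;> omega),
      face_slot _ _ _ (by omega) (by omega),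
      degeneracy_slot _ _ _ (by omega) (by split_ifs <;> omega)]
    congr 2
    split_ifs <;> omega
  d_s_self m i hi x := by
    refine DFunLike.congr_fun (f := (face F m i).comp (degeneracy F m i))
      (g := AlgHom.id k _) (algHom_ext_slot F fun c hc a => ?_) x
    simp only [AlgHom.comp_apply, AlgHom.id_apply]
    rw [degeneracy_slot _ _ _ (by omega) (by omega),
      face_slot _ _ _ (by omega) (by split_ifs <;> omega)]
    congr 2
    split_ifs <;> omega
  d_succ_s m i hi x := by
    refine DFunLike.congr_fun (f := (face F m (i + 1)).comp (degeneracy F m i))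
      (g := AlgHom.id k _) (algHom_ext_slot F fun c hc a => ?_) x
    simp only [AlgHom.comp_apply, AlgHom.id_apply]
    rw [degeneracy_slot _ _ _ (by omega) (by omega),
      face_slot _ _ _ (by omega) (by split_ifs <;> omega)]
    congr 2
    split_ifs <;> omega
  d_s_of_lt m i j hij hi x := by
    refine DFunLike.congr_fun (f := (face F (m + 1) (i + 1)).comp (degeneracy F (m + 1) j))
      (g := (degeneracy F m j).comp (face F m i)) (algHom_ext_slot F fun c hc a => ?_) x
    simp only [AlgHom.comp_apply]
    rw [degeneracy_slot _ _ _ (by omega) (by omega),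
      face_slot _ _ _ (by omega) (by split_ifs <;> omega),
      face_slot _ _ _ (by omega) (by omega),
      degeneracy_slot _ _ _ (by omega) (by split_ifs <;> omega)]
    congr 2
    split_ifs <;> omega
  d_zero_t m x := by
    refine DFunLike.congr_fun (f := (face F m 0).comp (cyclic F (m + 1)))
      (g := face F m (m + 1)) (algHom_ext_slot F fun c hc a => ?_) x
    simp only [AlgHom.comp_apply]
    rw [cyclic_slot _ _ _ (by omega), face_slot _ _ _ (by omega) (by omega),
      face_slot _ _ _ (by omega) (by omega)]
    congr 2
    split_ifs <;> omega
  d_succ_t m i hi x := by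
    refine DFunLike.congr_fun (f := (face F m (i + 1)).comp (cyclic F (m + 1)))
      (g := (cyclic F m).comp (face F m i)) (algHom_ext_slot F fun c hc a => ?_) x
    simp only [AlgHom.comp_apply]
    rw [cyclic_slot _ _ _ (by omega), face_slot _ _ _ (by omega) (by omega),
      face_slot _ _ _ (by omega) (by omega), cyclic_slot _ _ _ (by split_ifs <;> omega)]
    congr 2
    split_ifs <;> omega

/-- The alternating sum of the faces. -/
noncomputable def boundary (m : ℕ) :
    (⨂[k] _ : Fin (m + 1 + 1), A) →+ ⨂[k] _ : Fin (m + 1), A :=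
  (paracyclicRing k A F).D m

theorem boundary_apply (m : ℕ) (x : ⨂[k] _ : Fin (m + 1 + 1), A) :
    boundary F m x = ∑ i ∈ Finset.range (m + 2), (-1) ^ i * face F m i x :=
  (paracyclicRing k A F).D_apply_eq_sum_mul m x

end

/-- For the `p ^ n`-th power map the induced endomorphism of a tensor power is again the `p ^ n`-th
power map, so that the exactness criterion for power maps applies. -/
theorem exact_boundary_powFrobenius (p n : ℕ) [Fact p.Prime] (A : Type u) [CommRing A]
    [Algebra (ZMod p) A] (hn : n ≠ 0) (m : ℕ) (x : ⨂[ZMod p] _ : Fin (m + 1 + 1), A)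
    (hx : boundary (powFrobenius p n A) m x = 0) :
    ∃ w, boundary (powFrobenius p n A) (m + 1) w = x := by
  obtain ⟨w, hw⟩ := ParacyclicRing.exact_of_iterate_t_eq_pow
    (paracyclicRing (ZMod p) A (powFrobenius p n A)) (q := p ^ n)
    ((Fact.out : p.Prime).two_le.trans (Nat.le_self_pow hn p))
    (fun m y => iterate_cyclic (powFrobenius p n A) m (powFrobenius p n _)
      (fun c a => (map_pow (slot (powFrobenius p n A) m c) a (p ^ n)).symm) y) hx
  exact ⟨w, hw⟩

end TwistedTensorPower

/-! ### Comparison with the Hochschild complex -/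

namespace Hochschild

section

variable (p n : ℕ) [Fact p.Prime] (A : Type u) [CommRing A] [Algebra (ZMod p) A]

open TwistedTensorPower

/-- The slots of a Hochschild chain `b ⊗ r₁ ⊗ ⋯ ⊗ rₘ`, in reverse order: the coefficient `b`
(the right summand) is in slot `0` and `rₗ` is in slot `m + 1 - l`. -/
def slotEquiv (m : ℕ) : Fin m ⊕ Unit ≃ Fin (m + 1) :=
  (Equiv.optionEquivSumPUnit (Fin m)).symm.trans (finSuccEquivLast.symm.trans Fin.revPerm)

/-- The Hochschild `m`-chains with coefficients in `Φⁿ(A)`, as the tensor power `A^{⊗ (m + 1)}`. -/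
noncomputable def chainsEquiv (m : ℕ) :
    Chains (ZMod p) A (FrobeniusTwist p n A) m ≃ₗ[ZMod p] ⨂[ZMod p] _ : Fin (m + 1), A :=
  (TensorProduct.congr
      (((FrobeniusTwist.of p n A).restrictScalars (ZMod p)).symm.trans
        (PiTensorProduct.subsingletonEquiv (R := ZMod p) (s := fun _ : Unit => A) ()).symm)
      (LinearEquiv.refl _ _)).trans <|
    (TensorProduct.comm _ _ _).trans <|
      (PiTensorProduct.tmulEquiv (ZMod p) A).trans
        (PiTensorProduct.reindex (ZMod p) (fun _ => A) (slotEquiv m))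

theorem chainsEquiv_tmul_tprod (m : ℕ) (b : A) (r : Fin m → A) :
    chainsEquiv p n A m (FrobeniusTwist.of p n A b ⊗ₜ PiTensorProduct.tprod (ZMod p) r) =
      slot (powFrobenius p n A) m 0 b *
        ∏ l : Fin m, slot (powFrobenius p n A) m (m - l) (r l) := by
  have h : (PiTensorProduct.subsingletonEquiv (R := ZMod p) (s := fun _ : Unit => A) ()).symm b =
      PiTensorProduct.tprod (ZMod p) fun _ => b :=
    PiTensorProduct.subsingletonEquiv_symm_apply' _ _
  simp only [chainsEquiv, LinearEquiv.trans_apply, TensorProduct.congr_tmul, LinearEquiv.refl_apply,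
    TensorProduct.comm_tmul]
  change PiTensorProduct.reindex _ _ _ (PiTensorProduct.tmulEquiv _ _ (_ ⊗ₜ
    (PiTensorProduct.subsingletonEquiv (R := ZMod p) (s := fun _ : Unit => A) ()).symm b)) = _
  rw [h, PiTensorProduct.tmulEquiv_apply, PiTensorProduct.reindex_tprod,
    tprod_eq_prod_slot (powFrobenius p n A), ← Equiv.prod_comp (slotEquiv m),
    Fintype.prod_sum_type, mul_comm]
  simp [slotEquiv]

/-- Because of the reversed order, the `i`-th Hochschild face is the face `m + 1 - i`. -/
theorem chainsEquiv_face (m : ℕ) (i : Fin (m + 2))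
    (x : Chains (ZMod p) A (FrobeniusTwist p n A) (m + 1)) :
    chainsEquiv p n A m (face (ZMod p) A (FrobeniusTwist p n A) m i x) =
      TwistedTensorPower.face (powFrobenius p n A) m (m + 1 - i) (chainsEquiv p n A (m + 1) x) := by
  refine LinearMap.congr_fun (f := (chainsEquiv p n A m).toLinearMap ∘ₗ
      face (ZMod p) A (FrobeniusTwist p n A) m i)
    (g := (TwistedTensorPower.face (powFrobenius p n A) m (m + 1 - i)).toLinearMap ∘ₗ
      (chainsEquiv p n A (m + 1)).toLinearMap) ?_ x
  ext b r
  obtain ⟨b, rfl⟩ := (FrobeniusTwist.of p n A).surjective b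
  simp only [AlgebraTensorModule.curry_apply, LinearMap.coe_restrictScalars,
    LinearMap.compMultilinearMap_apply, curry_apply, LinearMap.comp_apply, LinearEquiv.coe_coe,
    AlgHom.toLinearMap_apply, chainsEquiv_tmul_tprod, map_mul, map_prod]
  obtain ⟨j, hj⟩ : ∃ j, m + 1 - (i : ℕ) = j := ⟨_, rfl⟩
  rw [hj, face_slot _ _ _ (by omega) (by omega), if_pos (Nat.zero_le _),
    Finset.prod_congr rfl fun (l : Fin (m + 1)) _ => face_slot (powFrobenius p n A) m j (by omega)
      (show m + 1 - (l : ℕ) ≤ m + 2 by omega) (r l)]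
  induction i using Fin.cases with
  | zero =>
    obtain rfl : j = m + 1 := hj.symm
    rw [face_zero_tmul_tprod, FrobeniusTwist.op_smul_of, chainsEquiv_tmul_tprod,
      Fin.prod_univ_succ, if_pos (Nat.sub_le _ _), Fin.val_zero, Nat.sub_zero, slot_self, map_mul,
      mul_comm (slot _ m 0 _) (slot _ m 0 b), mul_assoc]
    congr 2
    refine Finset.prod_congr rfl fun l _ => ?_
    rw [if_pos (Nat.sub_le _ _), Fin.val_succ, Nat.add_sub_add_right]
    rfl
  | succ i =>
    induction i using Fin.lastCases with
    | last =>
      obtain rfl : j = 0 := by simpa using hj.symm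
      rw [Fin.succ_last, face_last_tmul_tprod, ← map_smul, chainsEquiv_tmul_tprod,
        Fin.prod_univ_castSucc, smul_eq_mul, map_mul, mul_comm (slot _ m 0 _) (slot _ m 0 b),
        mul_assoc, mul_comm (slot _ m 0 (r _))]
      simp only [Fin.val_last, Fin.val_castSucc]
      congr 2
      · refine Finset.prod_congr rfl fun l _ => ?_
        rw [if_neg (by omega), show m + 1 - (l : ℕ) - 1 = m - l by omega]
        rfl
      · rw [if_neg (by omega), show m + 1 - m - 1 = 0 by omega]
    | cast i =>
      rw [Fin.val_succ, Fin.val_castSucc, Nat.add_sub_add_right] at hj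
      have hi : (i : ℕ) < m := i.isLt
      rw [face_succ_castSucc_tmul_tprod, chainsEquiv_tmul_tprod, Fin.prod_univ_succAbove _ i.succ]
      congr 1
      -- The factor `r (i + 1)` is absorbed into the slot of `r i`.
      have h : ∀ l : Fin m, slot (powFrobenius p n A) m (m - l) (mulAdjacent i r l) =
          slot (powFrobenius p n A) m (m - l) (if l = i then r i.succ else 1) *
            slot (powFrobenius p n A) m (m - l) (r (i.succ.succAbove l)) := by
        intro l
        rw [← map_mul]
        congr 1
        obtain h | rfl | h := lt_trichotomy l i
        · rw [mulAdjacent, if_pos h, if_neg h.ne, one_mul,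
            Fin.succAbove_of_castSucc_lt _ _ (Fin.castSucc_lt_succ_iff.2 h.le)]
        · rw [mulAdjacent, if_neg (lt_irrefl _), if_pos rfl, if_pos rfl,
            Fin.succAbove_of_castSucc_lt _ _ Fin.castSucc_lt_succ, mul_comm]
        · rw [mulAdjacent, if_neg h.not_gt, if_neg h.ne', if_neg h.ne', one_mul,
            Fin.succAbove_of_le_castSucc _ _ h]
      rw [Finset.prod_congr rfl fun l _ => h l, Finset.prod_mul_distrib]
      congr 1
      · rw [Finset.prod_eq_single i (fun l _ hl => by rw [if_neg hl, map_one]) (by simp),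
          if_pos rfl, Fin.val_succ, if_pos (by omega), Nat.add_sub_add_right]
      · refine Finset.prod_congr rfl fun l _ => ?_
        congr 2
        obtain h | h := le_or_gt l i
        · rw [Fin.succAbove_of_castSucc_lt _ _ (Fin.castSucc_lt_succ_iff.2 h), Fin.val_castSucc]
          have := Fin.le_def.1 h
          rw [if_neg (by omega)]
          omega
        · rw [Fin.succAbove_of_le_castSucc _ _ h, Fin.val_succ]
          have := Fin.lt_def.1 h
          rw [if_pos (by omega)]
          omega

/-- Reversing the order of the tensor factors changes the differential by a sign. -/
theorem chainsEquiv_differential (m : ℕ)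
    (x : Chains (ZMod p) A (FrobeniusTwist p n A) (m + 1)) :
    chainsEquiv p n A m (differential (ZMod p) A (FrobeniusTwist p n A) m x) =
      (-1) ^ (m + 1) * boundary (powFrobenius p n A) m (chainsEquiv p n A (m + 1) x) := by
  rw [boundary_apply, ← Finset.sum_range_reflect, differential, LinearMap.sum_apply, map_sum,
    Finset.mul_sum, ← Fin.sum_univ_eq_sum_range (fun i => (-1) ^ (m + 1) *
      ((-1) ^ (m + 2 - 1 - i) * TwistedTensorPower.face (powFrobenius p n A) m (m + 2 - 1 - i)
        (chainsEquiv p n A (m + 1) x)))]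
  refine Finset.sum_congr rfl fun i _ => ?_
  rw [LinearMap.smul_apply, map_zsmul, chainsEquiv_face, ← mul_assoc, ← pow_add, zsmul_eq_mul]
  have hi : (i : ℕ) ≤ m + 1 := Nat.lt_succ_iff.1 i.isLt
  rw [show m + 1 + (m + 2 - 1 - (i : ℕ)) = i + 2 * (m + 1 - i) by omega, pow_add, pow_mul,
    neg_one_sq, one_pow, mul_one]
  simp

theorem exact_differential (hn : n ≠ 0) (m : ℕ)
    (x : Chains (ZMod p) A (FrobeniusTwist p n A) (m + 1))
    (hx : differential (ZMod p) A (FrobeniusTwist p n A) m x = 0) :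
    ∃ w, differential (ZMod p) A (FrobeniusTwist p n A) (m + 1) w = x := by
  have hD : boundary (powFrobenius p n A) m (chainsEquiv p n A (m + 1) x) = 0 := by
    have h := chainsEquiv_differential p n A m x
    rw [hx, map_zero] at h
    exact ((isUnit_one.neg.pow (m + 1)).mul_right_eq_zero).1 h.symm
  obtain ⟨w, hw⟩ := exact_boundary_powFrobenius p n A hn m _ hD
  obtain ⟨v, hv⟩ : ∃ v, boundary (powFrobenius p n A) (m + 1) v =
      (-1) ^ (m + 2) * chainsEquiv p n A (m + 1) x := by
    obtain h | h := neg_one_pow_eq_or (⨂[ZMod p] _ : Fin (m + 1 + 1), A) (m + 2)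
    · exact ⟨w, by rw [h, hw, one_mul]⟩
    · exact ⟨-w, by rw [h, map_neg, hw, neg_one_mul]⟩
  refine ⟨(chainsEquiv p n A (m + 2)).symm v, (chainsEquiv p n A (m + 1)).injective ?_⟩
  rw [chainsEquiv_differential, LinearEquiv.apply_symm_apply, hv, ← mul_assoc, ← mul_pow,
    neg_one_mul, neg_neg, one_pow, one_mul]

end

/-! ### Homology of the Hochschild complex -/

section

variable (k : Type u) [CommRing k] (R : Type v) [Ring R] [Algebra k R]
variable (B : Type w) [AddCommGroup B] [Module k B]

/-- `C_0(R, B) = B`. -/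
noncomputable def chainsZeroEquiv : B ≃ₗ[k] Chains k R B 0 :=
  (TensorProduct.rid k B).symm.trans
    (TensorProduct.congr (LinearEquiv.refl k B) (PiTensorProduct.isEmptyEquiv (Fin 0)).symm)

theorem chainsZeroEquiv_apply (b : B) :
    chainsZeroEquiv k R B b = b ⊗ₜ PiTensorProduct.tprod k Fin.elim0 := by
  have h : (PiTensorProduct.isEmptyEquiv (R := k) (s := fun _ => R) (Fin 0)).symm 1 =
      PiTensorProduct.tprod k Fin.elim0 := by
    rw [LinearEquiv.symm_apply_eq, PiTensorProduct.isEmptyEquiv_apply_tprod]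
  simp [chainsZeroEquiv, h]

variable [Module R B] [Module Rᵐᵒᵖ B] [IsScalarTower k R B] [IsScalarTower k Rᵐᵒᵖ B]

theorem differential_zero_tmul_tprod (b : B) (r : Fin 1 → R) :
    differential k R B 0 (b ⊗ₜ PiTensorProduct.tprod k r) =
      chainsZeroEquiv k R B (MulOpposite.op (r 0) • b - r 0 • b) := by
  have h0 := face_zero_tmul_tprod k 0 b r
  have h1 := face_last_tmul_tprod k 0 b r
  rw [differential, LinearMap.sum_apply, Fin.sum_univ_two, chainsZeroEquiv_apply,
    TensorProduct.sub_tmul, sub_eq_add_neg]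
  refine congrArg₂ (· + ·) ?_ ?_
  · rw [LinearMap.smul_apply, h0, Fin.val_zero, pow_zero, one_smul]
    exact congrArg (fun s => _ ⊗ₜ PiTensorProduct.tprod k s) (Subsingleton.elim _ _)
  · rw [LinearMap.smul_apply, Fin.val_one, pow_one, neg_one_smul]
    refine congrArg Neg.neg (h1.trans ?_)
    exact congrArg (fun s => _ ⊗ₜ PiTensorProduct.tprod k s) (Subsingleton.elim _ _)

variable [SMulCommClass R Rᵐᵒᵖ B]

theorem isZero_homology_succ (m : ℕ)
    (h : ∀ x, differential k R B m x = 0 → ∃ w, differential k R B (m + 1) w = x) :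
    Limits.IsZero (homology k R B (m + 1)) := by
  rw [homology, ← HomologicalComplex.exactAt_iff_isZero_homology,
    HomologicalComplex.exactAt_iff' _ (m + 2) (m + 1) m (by simp) (by simp),
    ShortComplex.moduleCat_exact_iff]
  intro x hx
  simp only [HomologicalComplex.shortComplexFunctor'_obj_f,
    HomologicalComplex.shortComplexFunctor'_obj_g, HomologicalComplex.sc',
    complex_d] at hx ⊢
  exact h x hx

/-- In degree zero the map from the homology to the cokernel of the differential is an isomorphism;
it is used to compute with the class map. -/
theorem homologyι_classZero (b : B) :
    ((complex k R B).homologyι 0).hom (classZero k R B b) =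
      ((complex k R B).pOpcycles 0).hom (chainsZeroEquiv k R B b) := by
  have h : ((complex k R B).liftCycles (𝟙 ((complex k R B).X 0)) 0 (by simp) (by simp) ≫
      (complex k R B).homologyπ 0) ≫ (complex k R B).homologyι 0 =
      (complex k R B).pOpcycles 0 := by
    simp
  rw [chainsZeroEquiv_apply]
  exact congrArg (fun f => f.hom (b ⊗ₜ[k] PiTensorProduct.tprod k Fin.elim0)) h

theorem classZero_surjective : Function.Surjective (classZero k R B) := by
  intro y
  obtain ⟨x, hx⟩ := (ModuleCat.epi_iff_surjective ((complex k R B).pOpcycles 0)).1 inferInstance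
    (((complex k R B).homologyι 0).hom y)
  obtain ⟨b, rfl⟩ := (chainsZeroEquiv k R B).surjective x
  refine ⟨b, (ModuleCat.mono_iff_injective ((complex k R B).homologyι 0)).1 inferInstance ?_⟩
  exact (homologyι_classZero k R B b).trans hx

theorem classZero_eq_zero_iff (b : B) :
    classZero k R B b = 0 ↔
      ∃ w, differential k R B 0 w = b ⊗ₜ PiTensorProduct.tprod k Fin.elim0 := by
  have hex : (ShortComplex.mk ((complex k R B).d 1 0) ((complex k R B).pOpcycles 0)
      (by simp)).Exact :=
    ShortComplex.exact_of_g_is_cokernel _ ((complex k R B).opcyclesIsCokernel 1 0 (by simp))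
  rw [ShortComplex.moduleCat_exact_iff] at hex
  rw [← chainsZeroEquiv_apply]
  constructor
  · intro h
    have h' := homologyι_classZero k R B b
    rw [h, map_zero] at h'
    obtain ⟨w, hw⟩ := hex _ h'.symm
    simp only [complex_d] at hw
    exact ⟨w, hw⟩
  · rintro ⟨w, hw⟩
    refine (ModuleCat.mono_iff_injective ((complex k R B).homologyι 0)).1 inferInstance ?_
    refine (homologyι_classZero k R B b).trans ?_
    rw [← hw, map_zero]
    have h := congrArg (fun f => f.hom w) ((complex k R B).d_pOpcycles 1 0)
    rw [complex_d] at h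
    exact h

end

theorem classZero_of_eq_zero_iff (p n : ℕ) [Fact p.Prime] (A : Type u) [CommRing A]
    [Algebra (ZMod p) A] (a : A) :
    classZero (ZMod p) A (FrobeniusTwist p n A) (FrobeniusTwist.of p n A a) = 0 ↔
      a ∈ Ideal.span (Set.range fun a : A => a - a ^ p ^ n) := by
  rw [classZero_eq_zero_iff, ← chainsZeroEquiv_apply]
  constructor
  · rintro ⟨w, hw⟩
    let f : Chains (ZMod p) A (FrobeniusTwist p n A) 0 →ₗ[ZMod p] FrobeniusCoinvariants p n A :=
      (Ideal.Quotient.mkₐ (ZMod p) _).toLinearMap ∘ₗ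
        ((FrobeniusTwist.of p n A).restrictScalars (ZMod p)).symm.toLinearMap ∘ₗ
          (chainsZeroEquiv (ZMod p) A (FrobeniusTwist p n A)).symm.toLinearMap
    have hf : ∀ b : A, f (chainsZeroEquiv (ZMod p) A (FrobeniusTwist p n A)
        (FrobeniusTwist.of p n A b)) = Ideal.Quotient.mk _ b := fun b => by
      simp only [f, LinearMap.comp_apply, LinearEquiv.coe_coe, LinearEquiv.symm_apply_apply]
      rfl
    have hfd : f ∘ₗ differential (ZMod p) A (FrobeniusTwist p n A) 0 = 0 := by
      ext b r
      obtain ⟨b, rfl⟩ := (FrobeniusTwist.of p n A).surjective b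
      simp only [AlgebraTensorModule.curry_apply, LinearMap.coe_restrictScalars,
        LinearMap.compMultilinearMap_apply, curry_apply, LinearMap.comp_apply]
      rw [differential_zero_tmul_tprod (ZMod p) A (FrobeniusTwist p n A),
        FrobeniusTwist.op_smul_of, ← map_smul, ← map_sub, hf]
      refine Ideal.Quotient.eq_zero_iff_mem.2 ?_
      rw [smul_eq_mul, ← sub_mul, ← neg_sub, neg_mul, ← mul_neg]
      exact Ideal.mul_mem_right _ _ (Ideal.subset_span ⟨r 0, rfl⟩)
    have h := LinearMap.congr_fun hfd w
    rw [LinearMap.comp_apply, hw, hf] at h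
    exact Ideal.Quotient.eq_zero_iff_mem.1 h
  · intro ha
    -- All multiples of `a` are treated at once, since the range of the differential is only
    -- known to be a subspace.
    suffices h : ∀ c : A, chainsZeroEquiv (ZMod p) A (FrobeniusTwist p n A)
        (FrobeniusTwist.of p n A (c * a)) ∈
          LinearMap.range (differential (ZMod p) A (FrobeniusTwist p n A) 0) by
      simpa using h 1
    induction ha using Submodule.span_induction with
    | mem x hx =>
      obtain ⟨a, rfl⟩ := hx
      intro c
      refine ⟨(FrobeniusTwist.of p n A (-c) : FrobeniusTwist p n A) ⊗ₜ
        PiTensorProduct.tprod (ZMod p) fun _ => a, ?_⟩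
      rw [differential_zero_tmul_tprod (ZMod p) A (FrobeniusTwist p n A),
        FrobeniusTwist.op_smul_of, ← map_smul, ← map_sub,
        smul_eq_mul]
      congr 2
      ring
    | zero => simp
    | add x y _ _ hx hy =>
      intro c
      rw [mul_add, map_add, map_add]
      exact add_mem (hx c) (hy c)
    | smul b x _ hx =>
      intro c
      rw [smul_eq_mul, ← mul_assoc]
      exact hx (c * b)

end Hochschild

theorem mainTheorem1 (p : ℕ) [Fact p.Prime] (A : Type u) [CommRing A] [Algebra (ZMod p) A]
    (n : ℕ) (hn : 1 < n) :
    (∀ i : ℕ, 0 < i →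
      Limits.IsZero (Hochschild.homology (ZMod p) A (FrobeniusTwist p n A) i)) ∧
    ∃ e : Hochschild.homology (ZMod p) A (FrobeniusTwist p n A) 0
        ≃ₗ[ZMod p] FrobeniusCoinvariants p n A,
      ∀ a : A, e (Hochschild.classZero (ZMod p) A (FrobeniusTwist p n A)
        (FrobeniusTwist.of p n A a)) = Ideal.Quotient.mk _ a := by
  constructor
  · intro i hi
    obtain ⟨m, rfl⟩ : ∃ m, i = m + 1 := ⟨i - 1, by omega⟩
    exact Hochschild.isZero_homology_succ _ _ _ m
      (Hochschild.exact_differential p n A (by omega) m)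
  · let f : A →ₗ[ZMod p] Hochschild.homology (ZMod p) A (FrobeniusTwist p n A) 0 :=
      Hochschild.classZero (ZMod p) A (FrobeniusTwist p n A) ∘ₗ
        ((FrobeniusTwist.of p n A).restrictScalars (ZMod p)).toLinearMap
    let g : A →ₗ[ZMod p] FrobeniusCoinvariants p n A :=
      (Ideal.Quotient.mkₐ (ZMod p) _).toLinearMap
    have hf : Function.Surjective f :=
      (Hochschild.classZero_surjective (ZMod p) A (FrobeniusTwist p n A)).comp
        (FrobeniusTwist.of p n A).surjective
    have hg : Function.Surjective g := Ideal.Quotient.mk_surjective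
    have hfg : LinearMap.ker f = LinearMap.ker g := by
      ext a
      exact (Hochschild.classZero_of_eq_zero_iff p n A a).trans Ideal.Quotient.eq_zero_iff_mem.symm
    refine ⟨(f.quotKerEquivOfSurjective hf).symm.trans
      ((Submodule.quotEquivOfEq _ _ hfg).trans (g.quotKerEquivOfSurjective hg)), fun a => ?_⟩
    have h : (f.quotKerEquivOfSurjective hf).symm (f a) = Submodule.Quotient.mk a :=
      (LinearEquiv.symm_apply_eq _).2 rfl
    change (g.quotKerEquivOfSurjective hg) (Submodule.quotEquivOfEq _ _ hfg
      ((f.quotKerEquivOfSurjective hf).symm (f a))) = _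
    rw [h]
    rfl
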